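/- Let $n \ge 1$ and $k \ge 0$ be integers. Let $C_n = \{\widehat{0}, b_1, \dots, b_n\}$ be the $n$-claw, the poset in which each $b_j$ covers $\widehat{0}$ and there are no other relations between distinct elements. Let $\mathcal{F}_k(C_n)$ be the set of maps $f : C_n \to \{0, 1, \dots, k\}$ such that $x \le y$ implies $f(x) \ge f(y)$; that is, $f(b_j) \le f(\widehat{0})$ for all $j$. For $x \in C_n$, the whirl $w_x : \mathcal{F}_k(C_n) \to \mathcal{F}_k(C_n)$ at $x$ repeatedly adds $1$ modulo $k+1$ to the value $f(x)$, at least once, until the map is again in $\mathcal{F}_k(C_n)$. Let $w = w_{x_1} w_{x_2} \cdots w_{x_{n+1}}$ (the rightmost map being applied first), where $(x_1, \dots, x_{n+1})$ is any linear extension of $C_n$. For $A \subseteq \{0, \dots, k\}$ let $\mathcal{F}_k^A(C_n)$ be the set of all $f \in \mathcal{F}_k(C_n)$ with $f(b_j) \in A$ for all $j$, and let $\overline{w}_A : \mathcal{F}_k^A(C_n) \to \mathcal{F}_k^A(C_n)$ be the map that keeps the label of $\widehat{0}$ and whirls each leaf label within $A$: it replaces $f(b_j)$, for every $j$, by the first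 of the values $f(b_j)+1, f(b_j)+2, \dots$ (modulo $k+1$) that lies in $A$ and is at most $f(\widehat{0})$. For $f \in \mathcal{F}_k(C_n)$ let $A(f) = \{f(b_1), \dots, f(b_n)\}$ and $\alpha = \#A(f)$. (Every element of $A(f)$ is at most $f(\widehat{0})$, so $\overline{w}_{A(f)} f$ is obtained from $f$ by replacing each leaf label by its cyclic successor within $A(f)$.) Then, for every $f \in \mathcal{F}_k(C_n)$, $$w^{k+2} f = \overline{w}_{A(f)} f, \qquad\text{and hence}\qquad w^{\alpha(k+2)} f = f.$$ -/

import Mathlib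

/-- The set `F_k(P)` of `k`-bounded `P`-partitions: the maps `f : P → {0, …, k}` such that
`x ≤ y` implies `f x ≥ f y`. Labels live in `Fin (k + 1)`, whose addition is addition
modulo `k + 1`. -/
abbrev BoundedPPartition (k : ℕ) (P : Type*) [PartialOrder P] : Type _ :=
  {f : P → Fin (k + 1) // Antitone f}

theorem iterate_add_one_self {k : ℕ} (a : Fin (k + 1)) : (fun v => v + 1)^[k + 1] a = a := by
  have h : ∀ j : ℕ, (fun v : Fin (k + 1) => v + 1)^[j] a = a + j • (1 : Fin (k + 1)) := by
    intro j
    induction j with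
    | zero => simp
    | succ j ih => rw [Function.iterate_succ_apply', ih, succ_nsmul, add_assoc]
  rw [h]
  have h1 := card_nsmul_eq_zero (G := Fin (k + 1)) (x := 1)
  rw [Fintype.card_fin] at h1
  rw [h1, add_zero]

theorem exists_iterate_add_one {k : ℕ} {p : Fin (k + 1) → Prop} {a : Fin (k + 1)} (ha : p a) :
    ∃ j : ℕ, 1 ≤ j ∧ p ((fun v => v + 1)^[j] a) :=
  ⟨k + 1, by omega, by rw [iterate_add_one_self]; exact ha⟩

open Classical in
/-- Starting from a label `a` satisfying `p`, repeatedly add `1` modulo `k + 1` (at least once)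
until a label satisfying `p` is reached; the result is that label. In other words, this is the
cyclic successor of `a` within the set `{v | p v}`. -/
noncomputable def cyclicNext {k : ℕ} (p : Fin (k + 1) → Prop) (a : Fin (k + 1)) (ha : p a) :
    Fin (k + 1) :=
  (fun v => v + 1)^[Nat.find (exists_iterate_add_one ha)] a

theorem cyclicNext_spec {k : ℕ} (p : Fin (k + 1) → Prop) (a : Fin (k + 1)) (ha : p a) :
    p (cyclicNext p a ha) := by
  classical
  exact (Nat.find_spec (exists_iterate_add_one ha)).2

/-- The whirl `w_x` at `x`: repeatedly add `1` modulo `k + 1` to the label of `x` until the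
labelling is again a `k`-bounded `P`-partition. -/
noncomputable def whirlAt {k : ℕ} {P : Type*} [PartialOrder P] [DecidableEq P]
    (x : P) (f : BoundedPPartition k P) : BoundedPPartition k P :=
  ⟨Function.update f.1 x
    (cyclicNext (fun v => Antitone (Function.update f.1 x v)) (f.1 x)
      (by rw [Function.update_eq_self]; exact f.2)),
    cyclicNext_spec (fun v => Antitone (Function.update f.1 x v)) (f.1 x) _⟩

/-- The list `L = (x₁, …, x_p)` is a linear extension of the poset `P`: it lists every element
exactly once, and an element never precedes a strictly smaller one. -/
structure IsLinearExtension {P : Type*} [PartialOrder P] (L : List P) : Prop where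
  nodup : L.Nodup
  mem : ∀ x : P, x ∈ L
  ordered : L.Pairwise (fun x y => ¬ y < x)

/-- Whirling along `L = (x₁, …, x_p)`: the composite `w_{x₁} ∘ w_{x₂} ∘ ⋯ ∘ w_{x_p}`
(the whirl at `x_p` is applied first). -/
noncomputable def whirl {k : ℕ} {P : Type*} [PartialOrder P] [DecidableEq P]
    (L : List P) (f : BoundedPPartition k P) : BoundedPPartition k P :=
  L.foldr whirlAt f

/-- The elements of the `n`-claw: a bottom element and `n` leaves. -/
inductive Claw (n : ℕ) : Type where
  | bottom : Claw n
  | leaf (j : Fin n) : Claw n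
  deriving DecidableEq

/-- The order of the `n`-claw: the bottom element lies below everything, and the leaves are
pairwise incomparable. -/
instance Claw.instPartialOrder (n : ℕ) : PartialOrder (Claw n) where
  le x y := x = Claw.bottom ∨ x = y
  le_refl x := Or.inr rfl
  le_trans x y z := by
    rintro (rfl | rfl) h
    · exact Or.inl rfl
    · exact h
  le_antisymm x y := by
    rintro (rfl | rfl) (h | h)
    · exact h.symm
    · exact h.symm
    · rfl
    · rfl

theorem Claw.antitone_iff {n k : ℕ} (f : Claw n → Fin (k + 1)) :
    Antitone f ↔ ∀ j : Fin n, f (Claw.leaf j) ≤ f Claw.bottom := by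
  constructor
  · intro h j
    exact h (Or.inl rfl)
  · rintro h x y (rfl | rfl)
    · cases y with
      | bottom => exact le_rfl
      | leaf j => exact h j
    · exact le_rfl

/-- The set `F_k^A(C_n)` of those `f` in `F_k(C_n)` all of whose leaf labels lie in `A`. -/
abbrev ClawPartitionIn (k n : ℕ) (A : Finset (Fin (k + 1))) : Type :=
  {f : BoundedPPartition k (Claw n) // ∀ j : Fin n, f.1 (Claw.leaf j) ∈ A}

/-- The map `w̄_A` on `F_k^A(C_n)`, which whirls within `A` at every leaf: to each leaf label one
repeatedly adds `1` modulo `k + 1` until the label lies in `A` and is compatible with the label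
of the bottom element, which does not change. There are no relations between the leaves, so
all of them can be updated at once. If `A` is the set of leaf labels of `f`, then every element
of `A` is at most the bottom label, and each leaf label is replaced by its cyclic successor
in `A`. -/
noncomputable def whirlWithin {k n : ℕ} (A : Finset (Fin (k + 1)))
    (f : ClawPartitionIn k n A) : ClawPartitionIn k n A :=
  ⟨⟨fun x => match x with
      | Claw.bottom => f.1.1 Claw.bottom
      | Claw.leaf j => cyclicNext (fun v => v ∈ A ∧ v ≤ f.1.1 Claw.bottom)
          (f.1.1 (Claw.leaf j)) ⟨f.2 j, (Claw.antitone_iff f.1.1).1 f.1.2 j⟩,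
    (Claw.antitone_iff _).2 fun j =>
      (cyclicNext_spec (fun v => v ∈ A ∧ v ≤ f.1.1 Claw.bottom) (f.1.1 (Claw.leaf j))
        ⟨f.2 j, (Claw.antitone_iff f.1.1).1 f.1.2 j⟩).2⟩,
    fun j =>
      (cyclicNext_spec (fun v => v ∈ A ∧ v ≤ f.1.1 Claw.bottom) (f.1.1 (Claw.leaf j))
        ⟨f.2 j, (Claw.antitone_iff f.1.1).1 f.1.2 j⟩).1⟩

/-- The set `A(f)` of the labels of the leaves. -/
def leafLabels {k n : ℕ} (f : BoundedPPartition k (Claw n)) : Finset (Fin (k + 1)) :=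
  Finset.univ.image fun j : Fin n => f.1 (Claw.leaf j)

theorem mem_leafLabels {k n : ℕ} (f : BoundedPPartition k (Claw n)) (j : Fin n) :
    f.1 (Claw.leaf j) ∈ leafLabels f :=
  Finset.mem_image_of_mem _ (Finset.mem_univ j)

/-! One application of `w` acts on the leaves first: a label below the bottom label `c` rises by
one, and a label equal to `c` drops to `0`. Then `c` rises by one or, if it was `k`, falls to the
largest leaf label. Although labels are residues modulo `k + 1`, the motion has period `k + 2`. Draw
`α + 1` lines climbing cyclically through `0, …, k + 1`. They start at the `α` distinct leaf labels
and at one extra height: `c`, or `k + 1` if some leaf already equals `c`. Each class of equal leaves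
rides on its own line, and the highest line carries no leaf. The bottom rides on that line until it
reaches `k + 1`; then the bottom equals the leaf label on the second-highest line. At the next step
the free line wraps to `0` and that class drops to `0` with it, so the second-highest line becomes
the free one. After `k + 2` steps every line is back at its start and has wrapped once, so every
class has moved to the next line up, cyclically among the leaf labels. `ClawState.step` proves the
invariant, `sequence_period` reads off the result, and `whirl_iterate_apply` applies it to the
whirl. -/

/-! ### Computing cyclic successors. -/

theorem val_iterate_add_one {k : ℕ} (a : Fin (k + 1)) (i : ℕ) :
    ((fun v : Fin (k + 1) => v + 1)^[i] a).val = (a.val + i) % (k + 1) := by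
  induction i with
  | zero => simp [Nat.mod_eq_of_lt a.isLt]
  | succ i ih =>
    rw [Function.iterate_succ_apply', Fin.val_add, ih, Fin.val_one', ← Nat.add_mod, add_assoc]

/-- A label `b` satisfying `p` is the cyclic successor of `a` if no label satisfying `p` lies
strictly between `a` and `b` in the cyclic order. -/
theorem cyclicNext_eq {k : ℕ} {p : Fin (k + 1) → Prop} {a b : Fin (k + 1)} (ha : p a) (hb : p b)
    (h : (a < b ∧ ∀ v, p v → a < v → b ≤ v) ∨ (b ≤ a ∧ ∀ v, p v → b ≤ v ∧ v ≤ a)) :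
    cyclicNext p a ha = b := by
  classical
  have ha' := a.isLt
  have hb' := b.isLt
  obtain ⟨m, hm1, hmb, hm⟩ : ∃ m : ℕ, 1 ≤ m ∧ (fun v : Fin (k + 1) => v + 1)^[m] a = b ∧
      ∀ i, 1 ≤ i → i < m → ¬ p ((fun v : Fin (k + 1) => v + 1)^[i] a) := by
    rcases h with ⟨hab, h⟩ | ⟨hba, h⟩
    · refine ⟨b.val - a.val, by omega, ?_, fun i hi1 hi2 hp => ?_⟩
      · apply Fin.ext
        rw [val_iterate_add_one, Nat.mod_eq_of_lt (by omega)]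
        omega
      · have hv := val_iterate_add_one a i
        rw [Nat.mod_eq_of_lt (by omega)] at hv
        have := h _ hp (by rw [Fin.lt_def, hv]; omega)
        rw [Fin.le_def, hv] at this
        omega
    · rw [Fin.le_def] at hba
      -- The path wraps once; for `b = a` it is a full turn of `k + 1` steps.
      refine ⟨b.val + (k + 1) - a.val, by omega, ?_, fun i hi1 hi2 hp => ?_⟩
      · apply Fin.ext
        rw [val_iterate_add_one, show a.val + (b.val + (k + 1) - a.val) = b.val + (k + 1) by omega,
          Nat.add_mod_right, Nat.mod_eq_of_lt hb']
      · have hv := val_iterate_add_one a i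
        have h2 := h _ hp
        rw [Fin.le_def, Fin.le_def, hv] at h2
        by_cases hlt : a.val + i < k + 1
        · rw [Nat.mod_eq_of_lt hlt] at h2
          omega
        · rw [Nat.mod_eq_sub_mod (by omega), Nat.mod_eq_of_lt (by omega)] at h2
          omega
  have hfind : Nat.find (exists_iterate_add_one ha) = m := by
    rw [Nat.find_eq_iff]
    refine ⟨⟨hm1, by rw [hmb]; exact hb⟩, ?_⟩
    rintro i hi ⟨hi1, hp⟩
    exact hm i hi1 hi hp
  unfold cyclicNext
  rw [← hmb]
  convert rfl using 2
  exact hfind.symm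

/-! ### A single whirl on the claw. -/

theorem whirlAt_apply_of_ne {k : ℕ} {P : Type*} [PartialOrder P] [DecidableEq P]
    (x y : P) (hyx : y ≠ x) (f : BoundedPPartition k P) : (whirlAt x f).1 y = f.1 y :=
  Function.update_of_ne hyx _ _

theorem Claw.leaf_le_bottom {n k : ℕ} (f : BoundedPPartition k (Claw n)) (j : Fin n) :
    f.1 (Claw.leaf j) ≤ f.1 Claw.bottom :=
  (Claw.antitone_iff f.1).1 f.2 j

theorem Claw.antitone_update_leaf_iff {n k : ℕ} (f : BoundedPPartition k (Claw n)) (j : Fin n)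
    (v : Fin (k + 1)) :
    Antitone (Function.update f.1 (Claw.leaf j) v) ↔ v ≤ f.1 Claw.bottom := by
  rw [Claw.antitone_iff]
  constructor
  · intro h
    simpa using h j
  · intro h i
    by_cases hij : i = j
    · subst hij
      simpa using h
    · simpa [hij] using Claw.leaf_le_bottom f i

theorem Claw.antitone_update_bottom_iff {n k : ℕ} (f : BoundedPPartition k (Claw n))
    (v : Fin (k + 1)) :
    Antitone (Function.update f.1 Claw.bottom v) ↔ ∀ j, f.1 (Claw.leaf j) ≤ v := by
  rw [Claw.antitone_iff]
  simp

theorem val_whirlAt_leaf {n k : ℕ} (f : BoundedPPartition k (Claw n)) (j : Fin n) :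
    ((whirlAt (Claw.leaf j) f).1 (Claw.leaf j)).val =
      if (f.1 (Claw.leaf j)).val < (f.1 Claw.bottom).val
        then (f.1 (Claw.leaf j)).val + 1 else 0 := by
  have hle := Claw.leaf_le_bottom f j
  rw [Fin.le_def] at hle
  have hk := (f.1 Claw.bottom).isLt
  simp only [whirlAt, Function.update_self]
  split_ifs with h
  · rw [cyclicNext_eq (b := ⟨(f.1 (Claw.leaf j)).val + 1, by omega⟩)]
    · rw [Claw.antitone_update_leaf_iff, Fin.le_def]
      exact h
    · left
      refine ⟨by simp [Fin.lt_def], fun v _ hv => ?_⟩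
      rw [Fin.lt_def] at hv
      rw [Fin.le_def]
      exact hv
  · rw [cyclicNext_eq (b := 0)]
    · simp
    · rw [Claw.antitone_update_leaf_iff]
      exact Fin.zero_le _
    · right
      refine ⟨Fin.zero_le _, fun v hv => ⟨Fin.zero_le _, ?_⟩⟩
      rw [Claw.antitone_update_leaf_iff, Fin.le_def] at hv
      rw [Fin.le_def]
      omega

theorem val_whirlAt_bottom_of_lt {n k : ℕ} (f : BoundedPPartition k (Claw n))
    (h : (f.1 Claw.bottom).val < k) :
    ((whirlAt Claw.bottom f).1 Claw.bottom).val = (f.1 Claw.bottom).val + 1 := by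
  simp only [whirlAt, Function.update_self]
  rw [cyclicNext_eq (b := ⟨(f.1 Claw.bottom).val + 1, by omega⟩)]
  · rw [Claw.antitone_update_bottom_iff]
    intro j
    have hle := Claw.leaf_le_bottom f j
    rw [Fin.le_def] at hle ⊢
    exact hle.trans (Nat.le_succ _)
  · left
    refine ⟨by simp [Fin.lt_def], fun v _ hv => ?_⟩
    rw [Fin.lt_def] at hv
    rw [Fin.le_def]
    exact hv

/-- From `k` the label wraps to `0` and first becomes admissible at the largest leaf label.
Maximality need not be recorded, since the result is again antitone. -/
theorem exists_leaf_eq_whirlAt_bottom {n k : ℕ} (hn : 1 ≤ n) (f : BoundedPPartition k (Claw n))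
    (h : (f.1 Claw.bottom).val = k) :
    ∃ j, (whirlAt Claw.bottom f).1 Claw.bottom = f.1 (Claw.leaf j) := by
  have : Nonempty (Fin n) := ⟨⟨0, hn⟩⟩
  obtain ⟨j, hj⟩ := Finite.exists_max fun j : Fin n => f.1 (Claw.leaf j)
  refine ⟨j, ?_⟩
  simp only [whirlAt, Function.update_self]
  apply cyclicNext_eq
  · rw [Claw.antitone_update_bottom_iff]
    exact hj
  · right
    refine ⟨Claw.leaf_le_bottom f j, fun v hv => ?_⟩
    rw [Claw.antitone_update_bottom_iff] at hv
    refine ⟨hv j, ?_⟩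
    rw [Fin.le_def]
    omega

/-! ### One full whirl along a linear extension. -/

theorem IsLinearExtension.claw_eq_cons {n : ℕ} {L : List (Claw n)} (hL : IsLinearExtension L) :
    ∃ T : List (Claw n), L = Claw.bottom :: T ∧ Claw.bottom ∉ T ∧ T.Nodup ∧
      ∀ j, Claw.leaf j ∈ T := by
  obtain ⟨hd, hm, ho⟩ := hL
  cases L with
  | nil => exact absurd (hm Claw.bottom) (by simp)
  | cons x T =>
    have hx : x = Claw.bottom := by
      by_contra hne
      have hb : Claw.bottom ∈ T := by
        rcases List.mem_cons.1 (hm Claw.bottom) with h | h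
        · exact absurd h.symm hne
        · exact h
      exact (List.pairwise_cons.1 ho).1 _ hb (lt_of_le_of_ne (Or.inl rfl) (Ne.symm hne))
    subst hx
    refine ⟨T, rfl, (List.nodup_cons.1 hd).1, (List.nodup_cons.1 hd).2, fun j => ?_⟩
    simpa using hm (Claw.leaf j)

theorem whirl_apply_of_notMem {k : ℕ} {P : Type*} [PartialOrder P] [DecidableEq P]
    (T : List P) (y : P) (hy : y ∉ T) (f : BoundedPPartition k P) :
    (whirl T f).1 y = f.1 y := by
  induction T with
  | nil => rfl
  | cons x T ih =>
    rw [List.mem_cons, not_or] at hy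
    exact (whirlAt_apply_of_ne x y hy.1 _).trans (ih hy.2)

/-- A leaf whirl depends only on that leaf and the bottom, so the order of the leaves is immaterial.
-/
theorem val_whirl_leaf_of_bottom_notMem {n k : ℕ} (T : List (Claw n)) (hT : Claw.bottom ∉ T)
    (hd : T.Nodup) (f : BoundedPPartition k (Claw n)) (j : Fin n) (hj : Claw.leaf j ∈ T) :
    ((whirl T f).1 (Claw.leaf j)).val =
      if (f.1 (Claw.leaf j)).val < (f.1 Claw.bottom).val
        then (f.1 (Claw.leaf j)).val + 1 else 0 := by
  induction T with
  | nil => simp at hj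
  | cons x T ih =>
    rw [List.mem_cons, not_or] at hT
    rw [List.nodup_cons] at hd
    change ((whirlAt x (whirl T f)).1 (Claw.leaf j)).val = _
    by_cases hx : Claw.leaf j = x
    · subst hx
      rw [val_whirlAt_leaf, whirl_apply_of_notMem T _ hd.1, whirl_apply_of_notMem T _ hT.2]
    · rw [whirlAt_apply_of_ne _ _ hx]
      exact ih hT.2 hd.2 ((List.mem_cons.1 hj).resolve_left hx)

section LinearExtension

variable {n k : ℕ} {L : List (Claw n)}

theorem val_whirl_leaf (hL : IsLinearExtension L) (f : BoundedPPartition k (Claw n)) (j : Fin n) :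
    ((whirl L f).1 (Claw.leaf j)).val =
      if (f.1 (Claw.leaf j)).val < (f.1 Claw.bottom).val
        then (f.1 (Claw.leaf j)).val + 1 else 0 := by
  obtain ⟨T, rfl, hb, hd, hT⟩ := hL.claw_eq_cons
  rw [← val_whirl_leaf_of_bottom_notMem T hb hd f j (hT j)]
  exact congrArg _ (whirlAt_apply_of_ne _ _ (by simp) _)

theorem val_whirl_bottom_of_lt (hL : IsLinearExtension L) (f : BoundedPPartition k (Claw n))
    (h : (f.1 Claw.bottom).val < k) :
    ((whirl L f).1 Claw.bottom).val = (f.1 Claw.bottom).val + 1 := by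
  obtain ⟨T, rfl, hb, hd, hT⟩ := hL.claw_eq_cons
  have hf := whirl_apply_of_notMem T _ hb f
  rw [← hf] at h ⊢
  exact val_whirlAt_bottom_of_lt _ h

theorem exists_leaf_eq_whirl_bottom (hn : 1 ≤ n) (hL : IsLinearExtension L)
    (f : BoundedPPartition k (Claw n)) (h : (f.1 Claw.bottom).val = k) :
    ∃ j, (whirl L f).1 (Claw.leaf j) = (whirl L f).1 Claw.bottom := by
  obtain ⟨T, rfl, hb, hd, hT⟩ := hL.claw_eq_cons
  rw [← whirl_apply_of_notMem T _ hb f] at h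
  obtain ⟨j, hj⟩ := exists_leaf_eq_whirlAt_bottom hn _ h
  exact ⟨j, (whirlAt_apply_of_ne _ _ (by simp) _).trans hj.symm⟩

end LinearExtension

/-! ### The line picture for sequences of natural numbers. -/

/-- The value at time `t` of the line that starts at height `y` and climbs cyclically through
the heights `0, …, k + 1`, where `before` says that it has not yet passed `k + 1`. -/
def lineValue (k t y : ℕ) (before : Prop) [Decidable before] : ℕ :=
  if before then y + t else y + t - (k + 2)

/-- The index of the line that carries the `i`-th of `α` label classes when the lines that have
not yet passed the top are those of index less than `p`. -/
def lineIndex (α p i : ℕ) : ℕ :=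
  if i + 1 < p then i else if i + 1 < α ∨ 1 ≤ p then i + 1 else 0

/-- The height of the highest line when the lines of index less than `p` have not yet passed the
top. -/
def topLine (k α : ℕ) (e : ℕ → ℕ) (t p : ℕ) : ℕ :=
  if 1 ≤ p then e (p - 1) + t else e α + t - (k + 2)

/-- The labelling with bottom label `c` and leaf labels `g` at time `t`, in terms of the lines
with starting heights `e 0 < ⋯ < e α`; the bottom label rides on the highest line as long as
that line has height at most `k`. -/
structure ClawState {ι : Type*} (k α : ℕ) (e : ℕ → ℕ) (idx : ι → ℕ) (t p c : ℕ) (g : ι → ℕ) :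
    Prop where
  p_le : p ≤ α + 1
  before_iff : ∀ q ≤ α, q < p ↔ e q + t ≤ k + 1
  leaf_eq : ∀ j, g j =
    lineValue k t (e (lineIndex α p (idx j))) (lineIndex α p (idx j) < p)
  leaf_le : ∀ j, g j ≤ c
  bottom_eq : topLine k α e t p ≤ k → c = topLine k α e t p
  exists_leaf : k < topLine k α e t p → ∃ j, g j = c

/-- If the highest line is at height at most `k`, all leaves lie strictly below `c` and everything
climbs. If it is at `k + 1`, it wraps, one class changes line, and `p` drops by one. -/
theorem ClawState.step {ι : Type*} {k α : ℕ} {e : ℕ → ℕ} {idx : ι → ℕ} {t p c c' : ℕ}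
    {g g' : ι → ℕ} (hα : 1 ≤ α) (he : ∀ p q, p < q → q ≤ α → e p < e q) (heα : e α ≤ k + 1)
    (hidx : ∀ j, idx j < α) (hsurj : ∀ i < α, ∃ j, idx j = i) (ht : t < k + 2)
    (hs : ClawState k α e idx t p c g)
    (hck : c ≤ k) (hg' : ∀ j, g' j = if g j < c then g j + 1 else 0)
    (hle' : ∀ j, g' j ≤ c') (hc' : c < k → c' = c + 1) (hck' : c = k → ∃ j, g' j = c') :
    ∃ p', ClawState k α e idx (t + 1) p' c' g' := by
  obtain ⟨hp, hbef, hleaf, hle, hbot, hex⟩ := hs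
  have hmax : ∀ q ≤ α, e q ≤ e α := fun q hq => by
    rcases Nat.lt_or_eq_of_le hq with h | h
    · exact (he q α h le_rfl).le
    · rw [h]
  by_cases htop : topLine k α e t p ≤ k
  · have hc := hbot htop
    have hlt : ∀ j, g j < c := fun j => by
      have hi := hidx j
      rw [hleaf j, hc]
      unfold lineValue lineIndex topLine
      have h0 := hmax 0 (by omega)
      have h1 := hmax (idx j + 1) (by omega)
      have h2 := he (idx j)
      have h3 := hbef 0 (by omega)
      have h4 := hbef (idx j + 1) (by omega)
      have h5 := h2 (p - 1)
      have h6 := he (idx j + 1) α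
      have h7 := he 0 α
      have h8 := hbef α le_rfl
      split_ifs <;> omega
    have htop' : topLine k α e (t + 1) p = topLine k α e t p + 1 := by
      unfold topLine
      have h8 := hbef α le_rfl
      split_ifs <;> omega
    refine ⟨p, hp, ?_, ?_, hle', ?_, ?_⟩
    · intro q hq
      have h1 := hbef q hq
      have h2 := he q (p - 1)
      unfold topLine at htop
      rcases Nat.lt_trichotomy q (p - 1) with h | h | h
      · split_ifs at htop <;> omega
      · subst h
        split_ifs at htop <;> omega
      · omega
    · intro j
      rw [hg' j, if_pos (hlt j), hleaf j]
      have hi := hidx j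
      have hq : lineIndex α p (idx j) ≤ α := by
        unfold lineIndex
        split_ifs <;> omega
      have := hbef _ hq
      unfold lineValue
      split_ifs <;> omega
    · intro h
      rw [htop'] at h ⊢
      rw [hc' (by omega), hc]
    · intro h
      rw [htop'] at h
      exact hck' (by omega)
  -- If every line had passed the top, the highest would be at `e α + t - (k + 2) ≤ k`.
  · have hp1 : 1 ≤ p := by
      unfold topLine at htop
      split_ifs at htop <;> omega
    have hline : e (p - 1) + t = k + 1 := by
      have := hbef (p - 1) (by omega)
      unfold topLine at htop
      split_ifs at htop
      omega
    -- The exceptional class is the one on the second-highest line: line `p - 2`, or line `α` when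
    -- `p = 1`. Its line is the next highest one, and the class moves to the wrapping line `p - 1`.
    have hval : ∀ j, (lineIndex α p (idx j) = lineIndex α (p - 1) (idx j) ∧
          g j + 1 < topLine k α e (t + 1) (p - 1)) ∨
        ((idx j = if 2 ≤ p then p - 2 else α - 1) ∧
          g j + 1 = topLine k α e (t + 1) (p - 1) ∧
          lineIndex α (p - 1) (idx j) = p - 1) := fun j => by
      have hi := hidx j
      rw [hleaf j]
      unfold lineValue lineIndex topLine
      have h0 := hmax (idx j + 1) (by omega)
      have h1 := he (idx j) (p - 2)
      have h2 := he (idx j + 1) α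
      have h3 := hbef (idx j) (by omega)
      have h4 := hbef (idx j + 1) (by omega)
      have h5 := he 0 α
      have h6 := hbef α le_rfl
      have h7 : p - 1 - 1 = p - 2 := by omega
      rw [h7]
      rcases Nat.lt_trichotomy (idx j) (if 2 ≤ p then p - 2 else α - 1) with h | h | h
      · left
        constructor <;> split_ifs at h ⊢ <;> omega
      · right
        refine ⟨h, ?_, ?_⟩
        · by_cases hp2 : 2 ≤ p
          · rw [if_pos hp2] at h
            have h8 : p - 2 = idx j := h.symm
            rw [h8]
            split_ifs <;> omega
          · rw [if_neg hp2] at h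
            have h8 : idx j + 1 = α := by omega
            rw [h8]
            have h9 : p - 1 = 0 := by omega
            rw [h9] at hline
            split_ifs <;> omega
        · split_ifs at h ⊢ <;> omega
      · left
        constructor <;> split_ifs at h ⊢ <;> omega
    -- Some leaf has label `c` and none exceeds it, so `c` is the height of the second-highest line.
    have hcM : c + 1 = topLine k α e (t + 1) (p - 1) := by
      obtain ⟨j₀, hj₀⟩ := hex (by omega)
      obtain ⟨j₁, hj₁⟩ := hsurj (if 2 ≤ p then p - 2 else α - 1) (by split_ifs <;> omega)
      have h1 : g j₁ + 1 = topLine k α e (t + 1) (p - 1) := by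
        rcases hval j₁ with h | h
        · exfalso
          have h2 := h.1
          unfold lineIndex at h2
          split_ifs at hj₁ h2 <;> omega
        · exact h.2.1
      have h2 := hle j₁
      have h3 := hval j₀
      omega
    refine ⟨p - 1, by omega, ?_, ?_, hle', ?_, ?_⟩
    · intro q hq
      have h1 := hbef q hq
      have h2 := he q (p - 1)
      rcases Nat.lt_trichotomy q (p - 1) with h | h | h
      · omega
      · subst h
        omega
      · omega
    · intro j
      rw [hg' j]
      have hq : lineIndex α p (idx j) ≤ α := by
        have hi := hidx j
        unfold lineIndex
        split_ifs <;> omega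
      have h1 := hbef _ hq
      rcases hval j with ⟨h2, h3⟩ | ⟨-, h2, h3⟩
      · rw [if_pos (by omega), hleaf j, ← h2]
        have h4 : lineIndex α p (idx j) ≠ p - 1 := by
          rw [h2]
          have h5 := h2
          unfold lineIndex at h5 ⊢
          split_ifs at h5 ⊢ <;> omega
        unfold lineValue
        split_ifs <;> omega
      · rw [if_neg (by omega), h3]
        unfold lineValue
        split_ifs <;> omega
    · intro h
      rw [← hcM] at h ⊢
      exact hc' (by omega)
    · intro h
      exact hck' (by omega)

theorem ClawState.of_sequence {ι : Type*} {k α : ℕ} {e : ℕ → ℕ} {idx : ι → ℕ} {c : ℕ → ℕ}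
    {g : ℕ → ι → ℕ} (hα : 1 ≤ α) (he : ∀ p q, p < q → q ≤ α → e p < e q) (heα : e α ≤ k + 1)
    (hidx : ∀ j, idx j < α) (hsurj : ∀ i < α, ∃ j, idx j = i)
    (hck : ∀ t, c t ≤ k) (hg : ∀ t j, g (t + 1) j = if g t j < c t then g t j + 1 else 0)
    (hle : ∀ t j, g t j ≤ c t) (hc : ∀ t, c t < k → c (t + 1) = c t + 1)
    (hc' : ∀ t, c t = k → ∃ j, g (t + 1) j = c (t + 1))
    (hg0 : ∀ j, g 0 j = e (idx j)) (hc0 : e α ≤ k → c 0 = e α)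
    (hc0' : k < e α → ∃ j, g 0 j = c 0) (t : ℕ) (ht : t ≤ k + 2) :
    ∃ p, ClawState k α e idx t p (c t) (g t) := by
  induction t with
  | zero =>
    have htop : topLine k α e 0 (α + 1) = e α := by simp [topLine]
    refine ⟨α + 1, le_rfl, fun q hq => ?_, fun j => ?_, hle 0, ?_, ?_⟩
    · have := he q α
      rcases Nat.lt_or_eq_of_le hq with h | h
      · omega
      · subst h
        omega
    · have hi := hidx j
      rw [hg0]
      unfold lineValue lineIndex
      split_ifs <;> first | rfl | omega
    · rw [htop]
      exact hc0
    · rw [htop]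
      exact hc0'
  | succ t ih =>
    obtain ⟨p, hs⟩ := ih (by omega)
    exact hs.step hα he heα hidx hsurj (by omega) (hck t) (hg t) (hle (t + 1)) (hc t) (hc' t)

theorem sequence_period {ι : Type*} {k α : ℕ} {e : ℕ → ℕ} {idx : ι → ℕ} {c : ℕ → ℕ}
    {g : ℕ → ι → ℕ} (hα : 1 ≤ α) (he : ∀ p q, p < q → q ≤ α → e p < e q) (heα : e α ≤ k + 1)
    (hidx : ∀ j, idx j < α) (hsurj : ∀ i < α, ∃ j, idx j = i)
    (hck : ∀ t, c t ≤ k) (hg : ∀ t j, g (t + 1) j = if g t j < c t then g t j + 1 else 0)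
    (hle : ∀ t j, g t j ≤ c t) (hc : ∀ t, c t < k → c (t + 1) = c t + 1)
    (hc' : ∀ t, c t = k → ∃ j, g (t + 1) j = c (t + 1))
    (hg0 : ∀ j, g 0 j = e (idx j)) (hc0 : e α ≤ k → c 0 = e α)
    (hc0' : k < e α → ∃ j, g 0 j = c 0) :
    c (k + 2) = c 0 ∧ ∀ j, g (k + 2) j = e (if idx j + 1 < α then idx j + 1 else 0) := by
  obtain ⟨p, hs⟩ := ClawState.of_sequence hα he heα hidx hsurj hck hg hle hc hc' hg0 hc0 hc0'
    (k + 2) le_rfl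
  have hp : p = 0 := by
    have := hs.before_iff 0 (by omega)
    omega
  subst hp
  have htop : topLine k α e (k + 2) 0 = e α := by simp [topLine]
  have hgk : ∀ j, g (k + 2) j = e (if idx j + 1 < α then idx j + 1 else 0) := fun j => by
    rw [hs.leaf_eq j]
    simp [lineValue, lineIndex]
  refine ⟨?_, hgk⟩
  by_cases h : e α ≤ k
  · rw [hc0 h, hs.bottom_eq (by rw [htop]; exact h), htop]
  -- Here the free line is at `k + 1`, so at both times the bottom is the largest leaf label, which
  -- is `e (α - 1)`.
  · obtain ⟨j, hj⟩ := hc0' (by omega)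
    obtain ⟨j', hj'⟩ := hs.exists_leaf (by rw [htop]; omega)
    have hmono : ∀ i < α, e i ≤ e (α - 1) := fun i hi => by
      rcases Nat.lt_or_eq_of_le (Nat.le_sub_one_of_lt hi) with h1 | h1
      · exact (he _ _ h1 (by omega)).le
      · rw [h1]
    obtain ⟨j₀, hj₀⟩ := hsurj (α - 1) (by omega)
    -- This class carries the largest label at time `k + 2`; truncated subtraction also covers `α =
    -- 1`.
    obtain ⟨j₁, hj₁⟩ := hsurj (α - 2) (by omega)
    have h1 := hle 0 j₀
    have h2 := hle (k + 2) j₁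
    rw [hgk] at h2 hj'
    rw [hg0] at h1 hj
    rw [hj₀] at h1
    have h3 := hmono _ (hidx j)
    have h4 := hmono (if idx j' + 1 < α then idx j' + 1 else 0) (by split_ifs <;> omega)
    have h5 : (if idx j₁ + 1 < α then idx j₁ + 1 else 0) = α - 1 := by
      split_ifs <;> omega
    rw [h5] at h2
    omega

/-! ### From lines back to labellings. -/

/-- In a finite set `A` enumerated increasingly, the cyclic successor of an element has the cyclic
successor of its index. -/
theorem cyclicNext_orderEmbOfFin {k α : ℕ} {A : Finset (Fin (k + 1))} (hA : A.card = α)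
    {p : Fin (k + 1) → Prop} (hp : ∀ v, p v ↔ v ∈ A) (i i' : Fin α)
    (hi : i'.val = if i.val + 1 < α then i.val + 1 else 0) (ha : p (A.orderEmbOfFin hA i)) :
    cyclicNext p (A.orderEmbOfFin hA i) ha = A.orderEmbOfFin hA i' := by
  apply cyclicNext_eq
  · rw [hp]
    exact A.orderEmbOfFin_mem hA i'
  · have hex : ∀ v, p v → ∃ q, A.orderEmbOfFin hA q = v := fun v hv => by
      have : v ∈ Set.range (A.orderEmbOfFin hA) := by
        rw [Finset.range_orderEmbOfFin]
        exact (hp v).1 hv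
      exact this
    split_ifs at hi with h
    · left
      refine ⟨?_, fun v hv hlt => ?_⟩
      · rw [OrderEmbedding.lt_iff_lt, Fin.lt_def]
        omega
      · obtain ⟨q, rfl⟩ := hex v hv
        rw [OrderEmbedding.lt_iff_lt, Fin.lt_def] at hlt
        rw [OrderEmbedding.le_iff_le, Fin.le_def]
        omega
    · right
      refine ⟨?_, fun v hv => ?_⟩
      · rw [OrderEmbedding.le_iff_le, Fin.le_def]
        omega
      · obtain ⟨q, rfl⟩ := hex v hv
        rw [OrderEmbedding.le_iff_le, OrderEmbedding.le_iff_le, Fin.le_def, Fin.le_def]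
        omega

section LeafIndex

variable {n k : ℕ}

theorem exists_leafIndex (f : BoundedPPartition k (Claw n)) {A : Finset (Fin (k + 1))}
    (hA : leafLabels f = A) :
    ∃ idx : Fin n → Fin A.card, (∀ j, f.1 (Claw.leaf j) = A.orderEmbOfFin rfl (idx j)) ∧
      Function.Surjective idx := by
  subst hA
  have h : ∀ j, ∃ i, (leafLabels f).orderEmbOfFin rfl i = f.1 (Claw.leaf j) := fun j => by
    have : f.1 (Claw.leaf j) ∈ Set.range ((leafLabels f).orderEmbOfFin rfl) := by
      rw [Finset.range_orderEmbOfFin]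
      exact mem_leafLabels f j
    exact this
  choose idx hidx using h
  refine ⟨idx, fun j => (hidx j).symm, fun i => ?_⟩
  have hi := (leafLabels f).orderEmbOfFin_mem rfl i
  obtain ⟨j, -, hj⟩ := Finset.mem_image.1 hi
  exact ⟨j, ((leafLabels f).orderEmbOfFin rfl).injective ((hidx j).trans hj)⟩

theorem whirl_iterate_apply (hn : 1 ≤ n) {L : List (Claw n)} (hL : IsLinearExtension L)
    (f : BoundedPPartition k (Claw n)) {A : Finset (Fin (k + 1))} (idx : Fin n → Fin A.card)
    (hidx : ∀ j, f.1 (Claw.leaf j) = A.orderEmbOfFin rfl (idx j))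
    (hsurj : Function.Surjective idx) :
    ((whirl L)^[k + 2] f).1 Claw.bottom = f.1 Claw.bottom ∧
      ∀ j (i : Fin A.card), i.val = (if (idx j).val + 1 < A.card then (idx j).val + 1 else 0) →
        ((whirl L)^[k + 2] f).1 (Claw.leaf j) = A.orderEmbOfFin rfl i := by
  classical
  have hα : 1 ≤ A.card := (idx ⟨0, hn⟩).pos
  -- The start of the free line, strictly above all leaf labels in either case.
  let H : ℕ := if ∃ j, f.1 (Claw.leaf j) = f.1 Claw.bottom then k + 1 else (f.1 Claw.bottom).val
  let e : ℕ → ℕ := fun i => if h : i < A.card then (A.orderEmbOfFin rfl ⟨i, h⟩).val else H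
  have he1 : ∀ i : Fin A.card, e i = (A.orderEmbOfFin rfl i).val := fun i => by simp [e]
  have he2 : e A.card = H := by simp [e]
  have hck : ∀ h : BoundedPPartition k (Claw n), (h.1 Claw.bottom).val ≤ k := fun h =>
    Nat.le_of_lt_succ (h.1 Claw.bottom).isLt
  have hAH : ∀ i : Fin A.card, e i < H := fun i => by
    obtain ⟨j, rfl⟩ := hsurj i
    rw [he1, ← hidx]
    simp only [H]
    split_ifs with h
    · exact (f.1 _).isLt
    · exact lt_of_le_of_ne (Claw.leaf_le_bottom f j) fun h' => h ⟨j, Fin.ext h'⟩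
  have he : ∀ p q, p < q → q ≤ A.card → e p < e q := fun p q hpq hq => by
    rcases Nat.lt_or_eq_of_le hq with h | h
    · have h1 := he1 ⟨p, by omega⟩
      have h2 := he1 ⟨q, h⟩
      simp only at h1 h2
      rw [h1, h2, ← Fin.lt_def, OrderEmbedding.lt_iff_lt]
      exact hpq
    · rw [h, he2]
      exact hAH ⟨p, by omega⟩
  have hH : e A.card ≤ k + 1 := by
    rw [he2]
    simp only [H]
    have := hck f
    split_ifs <;> omega
  obtain ⟨hb, hl⟩ := sequence_period (k := k) (idx := fun j => (idx j).val) (e := e)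
    (c := fun t => (((whirl L)^[t] f).1 Claw.bottom).val)
    (g := fun t j => (((whirl L)^[t] f).1 (Claw.leaf j)).val) hα he hH
    (fun j => (idx j).isLt)
    (fun i hi => by
      obtain ⟨j, hj⟩ := hsurj ⟨i, hi⟩
      exact ⟨j, by rw [hj]⟩)
    (fun t => hck _)
    (fun t j => by
      simp only [Function.iterate_succ_apply']
      exact val_whirl_leaf hL _ j)
    (fun t j => Claw.leaf_le_bottom _ j)
    (fun t h => by
      simp only [Function.iterate_succ_apply']
      exact val_whirl_bottom_of_lt hL _ h)
    (fun t h => by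
      simp only [Function.iterate_succ_apply']
      obtain ⟨j, hj⟩ := exists_leaf_eq_whirl_bottom hn hL _ h
      exact ⟨j, congrArg _ hj⟩)
    (fun j => by
      rw [he1, ← hidx]
      rfl)
    (fun h => by
      rw [he2] at h ⊢
      simp only [H] at h ⊢
      split_ifs at h ⊢
      · omega
      · rfl)
    (fun h => by
      rw [he2] at h
      simp only [H] at h
      have := hck f
      split_ifs at h with h'
      · obtain ⟨j, hj⟩ := h'
        exact ⟨j, congrArg _ hj⟩
      · omega)
  refine ⟨Fin.ext hb, fun j i hi => Fin.ext ?_⟩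
  rw [← he1, hi]
  exact hl j

theorem whirl_iterate_eq_whirlWithin (hn : 1 ≤ n) {L : List (Claw n)} (hL : IsLinearExtension L)
    (f : BoundedPPartition k (Claw n)) :
    (whirl L)^[k + 2] f = (whirlWithin (leafLabels f) ⟨f, mem_leafLabels f⟩).1 := by
  obtain ⟨idx, hidx, hsurj⟩ := exists_leafIndex f rfl
  obtain ⟨hb, hl⟩ := whirl_iterate_apply hn hL f idx hidx hsurj
  apply Subtype.ext
  funext x
  cases x with
  | bottom => exact hb
  | leaf j =>
    have hp : ∀ v, (v ∈ leafLabels f ∧ v ≤ f.1 Claw.bottom) ↔ v ∈ leafLabels f := fun v => by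
      refine ⟨And.left, fun h => ⟨h, ?_⟩⟩
      obtain ⟨i, -, rfl⟩ := Finset.mem_image.1 h
      exact Claw.leaf_le_bottom f i
    have hlt : (if (idx j).val + 1 < (leafLabels f).card then (idx j).val + 1 else 0) <
        (leafLabels f).card := by
      have := (idx j).isLt
      split_ifs <;> omega
    rw [hl j ⟨_, hlt⟩ rfl]
    have key : ∀ a (ha : a ∈ leafLabels f ∧ a ≤ f.1 Claw.bottom),
        a = (leafLabels f).orderEmbOfFin rfl (idx j) →
        (leafLabels f).orderEmbOfFin rfl ⟨_, hlt⟩ =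
          cyclicNext (fun v => v ∈ leafLabels f ∧ v ≤ f.1 Claw.bottom) a ha := by
      rintro a ha rfl
      exact (cyclicNext_orderEmbOfFin rfl hp _ _ rfl _).symm
    exact key _ ⟨mem_leafLabels f j, Claw.leaf_le_bottom f j⟩ (hidx j)

/-- A rotated index map is still surjective, so the same `A` serves in every round of `k + 2` steps,
and each round adds one to the index modulo `A.card`. -/
theorem whirl_iterate_mul_apply (hn : 1 ≤ n) {L : List (Claw n)} (hL : IsLinearExtension L)
    (f : BoundedPPartition k (Claw n)) {A : Finset (Fin (k + 1))} [NeZero A.card]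
    (idx : Fin n → Fin A.card) (hidx : ∀ j, f.1 (Claw.leaf j) = A.orderEmbOfFin rfl (idx j))
    (hsurj : Function.Surjective idx) (m : ℕ) :
    ((whirl L)^[m * (k + 2)] f).1 Claw.bottom = f.1 Claw.bottom ∧
      ∀ j, ((whirl L)^[m * (k + 2)] f).1 (Claw.leaf j) =
        A.orderEmbOfFin rfl (idx j + Fin.ofNat A.card m) := by
  induction m with
  | zero => simpa using hidx
  | succ m ih =>
    obtain ⟨hb, hl⟩ := whirl_iterate_apply hn hL _ (fun j => idx j + Fin.ofNat A.card m) ih.2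
      ((Equiv.addRight (Fin.ofNat A.card m)).surjective.comp hsurj)
    rw [← Function.iterate_add_apply, show k + 2 + m * (k + 2) = (m + 1) * (k + 2) by ring]
      at hb hl
    refine ⟨hb.trans ih.1, fun j => hl j _ ?_⟩
    have h1 : (idx j + Fin.ofNat A.card (m + 1)).val =
        ((idx j + Fin.ofNat A.card m).val + 1) % A.card := by
      simp [Fin.val_add, Fin.ofNat, Nat.add_assoc]
    rw [h1]
    have h2 := (idx j + Fin.ofNat A.card m).isLt
    split_ifs with h
    · exact Nat.mod_eq_of_lt h
    · rw [show (idx j + Fin.ofNat A.card m).val + 1 = A.card by omega, Nat.mod_self]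

end LeafIndex

theorem theorem4p7 (n k : ℕ) (hn : 1 ≤ n) (L : List (Claw n)) (hL : IsLinearExtension L)
    (f : BoundedPPartition k (Claw n)) :
    (whirl L)^[k + 2] f = (whirlWithin (leafLabels f) ⟨f, mem_leafLabels f⟩).1 ∧
      (whirl L)^[(leafLabels f).card * (k + 2)] f = f := by
  refine ⟨whirl_iterate_eq_whirlWithin hn hL f, ?_⟩
  obtain ⟨idx, hidx, hsurj⟩ := exists_leafIndex f rfl
  have : NeZero (leafLabels f).card := ⟨(idx ⟨0, hn⟩).pos.ne'⟩
  obtain ⟨hb, hl⟩ := whirl_iterate_mul_apply hn hL f idx hidx hsurj (leafLabels f).card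
  apply Subtype.ext
  funext x
  cases x with
  | bottom => exact hb
  | leaf j =>
    rw [hl j, hidx j]
    simp
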